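/- Let $H=(V_H,E_H)$ be a fixed finite simple graph with at least two edges, let $P=(E_H,\prec)$ be any strict partial order on its edges, and let $$\rho_H=\min_{I}\frac{|V_I|}{|E_I|-1},$$ where the minimum is over all subgraphs $I=(V_I,E_I)$ of $H$ with $|E_I|\ge 2$. Let $\psi$ be a fixed probability distribution on $\mathbb{N}_0$ whose first and second moments are positive and finite. A random temporal graph $\mathcal{G}=([n],E,\lambda)$ drawn from $\Gamma_{[n]}(\psi)$ is obtained as follows: independently for each pair $e\in\binom{[n]}{2}$ one draws a number $l_e\sim\psi$, and $\lambda(e)$ is the set of $l_e$ independent samples, uniform on $(0,1]$ and independent of $l_e$; the edges are the pairs with at least one label. For $\delta\in\mathbb{R}$, a temporal graph $\mathcal{G}=(V,E,\lambda)$ contains $(H,P)$ as a $\delta$-temporal motif if there are a subgraph $(V',E')$ of $(V,E)$, a choice of one label $\lambda'(e)\in\lambda(e)$ for each $e\in E'$, and an isomorphism $\Phi$ from $H$ onto $(V',E')$ such that $\lambda'(\Phi(u)\Phi(v))<\lambda'(\Phi(w)\Phi(x))$ whenever $uv\prec wx$, and $\max_{e_1,e_2\in E'}\bigl(\lambda'(e_1)-\lambda'(e_2)\bigr)<\delta$.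 Then for every $\delta:\mathbb{N}\to\mathbb{R}$: 1. if $\delta(n)=\omega(n^{-\rho_H})$, i.e. $\delta(n)/n^{-\rho_H}\to+\infty$, then the probability that a sample from $\Gamma_{[n]}(\psi)$ contains $(H,P)$ as a $\delta(n)$-temporal motif tends to $1$ as $n\to\infty$; 2. if $\delta(n)=o(n^{-\rho_H})$, then the probability that a sample from $\Gamma_{[n]}(\psi)$ does not contain $(H,P)$ as a $\delta(n)$-temporal motif tends to $1$ as $n\to\infty$. -/

import Mathlib

open MeasureTheory Filter Topology Asymptotics

noncomputable section

/-- The sparsity of a finite graph `H`: the minimum of `|V_I| / (|E_I| - 1)` over the subgraphs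
`I` of `H` for which this ratio is meaningful, i.e. those with at least two edges. -/
def sparsity {W : Type*} (H : SimpleGraph W) : ℝ :=
  sInf {x : ℝ | ∃ I : H.Subgraph, 2 ≤ I.edgeSet.ncard ∧
    x = (I.verts.ncard : ℝ) / ((I.edgeSet.ncard : ℝ) - 1)}

/-- If `H` has at least two edges, the infimum in the definition of `sparsity` is a minimum. -/
theorem sparsity_isLeast {W : Type*} [Finite W] (H : SimpleGraph W)
    (hH : 2 ≤ H.edgeSet.ncard) :
    IsLeast {x : ℝ | ∃ I : H.Subgraph, 2 ≤ I.edgeSet.ncard ∧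
      x = (I.verts.ncard : ℝ) / ((I.edgeSet.ncard : ℝ) - 1)} (sparsity H) := by
  classical
  have hfin : Set.Finite {x : ℝ | ∃ I : H.Subgraph, 2 ≤ I.edgeSet.ncard ∧
      x = (I.verts.ncard : ℝ) / ((I.edgeSet.ncard : ℝ) - 1)} := by
    refine (Set.finite_range
      (fun I : H.Subgraph => (I.verts.ncard : ℝ) / ((I.edgeSet.ncard : ℝ) - 1))).subset ?_
    rintro x ⟨I, -, rfl⟩
    exact ⟨I, rfl⟩
  refine ⟨Set.Nonempty.csInf_mem ⟨_, ⊤, ?_, rfl⟩ hfin, fun x hx => csInf_le hfin.bddBelow hx⟩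
  simpa using hH

/-- A temporal graph on the vertex set `V`: a footprint graph together with a set of time labels
for each edge. Only the labels of edges of the footprint are meaningful. -/
structure TemporalGraph (V : Type*) where
  /-- The underlying static graph. -/
  footprint : SimpleGraph V
  /-- The set of occurrences of each edge. -/
  labels : Sym2 V → Set ℝ

/-- `G` contains `(H, P)` as a `δ`-temporal motif: there are a simple temporal subgraph
`(V', E', l)` of `G`, where `I = (V', E')` and `l` chooses one label of each edge of `E'`, and an
isomorphism `φ` of `H` onto `I` such that `l` respects the strict order `P` on the edges of `H`
and all the labels chosen lie within a duration less than `δ`. -/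
def TemporalGraph.ContainsMotif {V W : Type*} (G : TemporalGraph V) (H : SimpleGraph W)
    (P : H.edgeSet → H.edgeSet → Prop) (δ : ℝ) : Prop :=
  ∃ (I : G.footprint.Subgraph) (l : Sym2 V → ℝ) (φ : H ≃g I.coe),
    (∀ e ∈ I.edgeSet, l e ∈ G.labels e) ∧
    (∀ e f : H.edgeSet, P e f →
      l (Sym2.map (fun w => (φ w : V)) (e : Sym2 W)) <
        l (Sym2.map (fun w => (φ w : V)) (f : Sym2 W))) ∧
    (∀ e ∈ I.edgeSet, ∀ f ∈ I.edgeSet, l e - l f < δ)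

/-- `ψ` is a label multiplicity distribution: its first and second moments are positive and
finite. -/
structure IsLabelMultiplicity (ψ : PMF ℕ) : Prop where
  first_pos : 0 < ∑' k : ℕ, ψ k * (k : ENNReal)
  first_lt_top : ∑' k : ℕ, ψ k * (k : ENNReal) < ⊤
  second_pos : 0 < ∑' k : ℕ, ψ k * (k : ENNReal) ^ 2
  second_lt_top : ∑' k : ℕ, ψ k * (k : ENNReal) ^ 2 < ⊤

/-- The uniform distribution on `(0, 1]`. -/
def unifIoc : Measure ℝ := volume.restrict (Set.Ioc 0 1)

instance unifIoc_isProbabilityMeasure : IsProbabilityMeasure unifIoc :=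
  ⟨by simp [unifIoc]⟩

/-- The pairs of distinct vertices. -/
abbrev PotentialEdge (V : Type*) : Type _ := {e : Sym2 V // ¬ e.IsDiag}

/-- The sample space of the random temporal graph on `V`: each potential edge gets a number of
labels and an infinite sequence of candidate labels, of which only the first so many are used. -/
abbrev LabelSpace (V : Type*) : Type _ := PotentialEdge V → ℕ × (ℕ → ℝ)

/-- The randomness behind `Γ_V(ψ)`: independently for each potential edge, the number of labels
has law `ψ` and, independently of it, the candidate labels are i.i.d. uniform on `(0, 1]`. -/
def labelMeasure (V : Type*) [Fintype V] [DecidableEq V] (ψ : PMF ℕ) : Measure (LabelSpace V) :=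
  Measure.pi fun _ => ψ.toMeasure.prod (Measure.infinitePi fun _ : ℕ => unifIoc)

/-- The set of labels of `e` at the sample point `ω`: the first `l_e` candidate labels. -/
def sampledLabels {V : Type*} (ω : LabelSpace V) (e : Sym2 V) : Set ℝ :=
  {t | ∃ h : ¬ e.IsDiag, ∃ i < (ω ⟨e, h⟩).1, (ω ⟨e, h⟩).2 i = t}

/-- The random temporal graph `Γ_V(ψ)`, as a function on the sample space that carries
`labelMeasure V ψ`. The edges are the pairs that received at least one label. -/
def sampledGraph {V : Type*} (ω : LabelSpace V) : TemporalGraph V where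
  footprint := SimpleGraph.fromEdgeSet {e | (sampledLabels ω e).Nonempty}
  labels := sampledLabels ω

end

/-!
If `δ = o(n ^ (-ρ))`, a first-moment argument on the subgraph attaining `ρ = sparsity H` rules out
the motif: labels that pairwise differ by less than `δ` all lie in one of the windows
`[k δ, (k + 2) δ)`, and in one window the copies of a subgraph with `v` vertices and `r + 1` edges
number at most of order `n ^ v δ ^ (r + 1)` on average, so of order `n ^ v δ ^ r` over all windows.

If `δ = ω(n ^ (-ρ))`, cut `(0, 1]` into `K = ⌈1 / δ⌉` windows, each of them into one slot for every
possible height of an edge in the partial order, and count the copies of `H` whose edges have their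
first label in the prescribed slot of a common window. Each such copy is a motif. Two copies in
different windows are never positively correlated, since a shared edge would need its first label
in two windows at once; two copies in the same window sharing `r + 1` edges cost a factor of order
`K ^ (r + 1)`, while their shared vertices reduce the number of such pairs by a factor
`n ^ v ≥ n ^ (ρ r)`. As `K = o(n ^ ρ)`, Chebyshev's inequality applies.
-/

open ProbabilityTheory in
/-- Chebyshev's inequality for the number of events `A i` that occur. -/
theorem sq_sum_measureReal_mul_measureReal_iInter_compl_le {Ω ι : Type*} [MeasurableSpace Ω]
    [Fintype ι] (μ : Measure Ω) [IsProbabilityMeasure μ] {A : ι → Set Ω}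
    (hA : ∀ i, MeasurableSet (A i)) :
    (∑ i, μ.real (A i)) ^ 2 * μ.real (⋂ i, (A i)ᶜ) ≤
      ∑ i, ∑ j, (μ.real (A i ∩ A j) - μ.real (A i) * μ.real (A j)) := by
  set count : Ω → ℝ := fun ω => ∑ i, (A i).indicator 1 ω
  set mean : ℝ := ∑ i, μ.real (A i) with hmean
  have memLp_indicator (i : ι) : MemLp ((A i).indicator (1 : Ω → ℝ)) 2 μ :=
    (memLp_const 1).indicator (hA i)
  have integral_count : μ[count] = mean := by
    rw [integral_finsetSum _ fun i _ => (memLp_indicator i).integrable one_le_two]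
    simp only [integral_indicator_one (hA _), hmean]
  have variance_count : Var[count; μ] =
      ∑ i, ∑ j, (μ.real (A i ∩ A j) - μ.real (A i) * μ.real (A j)) := by
    rw [variance_fun_sum memLp_indicator]
    refine Finset.sum_congr rfl fun i _ => Finset.sum_congr rfl fun j _ => ?_
    rw [covariance_eq_sub (memLp_indicator i) (memLp_indicator j), ← Set.inter_indicator_one,
      integral_indicator_one ((hA i).inter (hA j)), integral_indicator_one (hA i),
      integral_indicator_one (hA j)]
  have hmean_nonneg : 0 ≤ mean := Finset.sum_nonneg fun i _ => measureReal_nonneg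
  rw [← variance_count]
  rcases hmean_nonneg.eq_or_lt with hzero | hpos
  · rw [← hzero, zero_pow two_ne_zero, zero_mul]
    exact variance_nonneg _ _
  rw [← le_div_iff₀' (by positivity)]
  refine ENNReal.toReal_le_of_le_ofReal (div_nonneg (variance_nonneg _ _) (sq_nonneg _)) ?_
  refine (measure_mono fun ω hω => ?_).trans (meas_ge_le_variance_div_sq (X := count)
    (memLp_finsetSum _ fun i _ => memLp_indicator i) hpos)
  have hcount_zero : count ω = 0 :=
    Finset.sum_eq_zero fun i _ => Set.indicator_of_notMem (Set.mem_iInter.1 hω i) _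
  rw [Set.mem_ofPred_eq, integral_count, hcount_zero, zero_sub, abs_neg]
  exact le_abs_self mean

theorem measure_pi_forall_mem {ι κ : Type*} [Fintype ι] [Fintype κ] {X : ι → Type*}
    [∀ i, MeasurableSpace (X i)] (μ : ∀ i, Measure (X i)) [∀ i, IsProbabilityMeasure (μ i)]
    {g : κ → ι} (hg : Function.Injective g) {S : ∀ a, Set (X (g a))}
    (hS : ∀ a, MeasurableSet (S a)) :
    Measure.pi μ {ω | ∀ a, ω (g a) ∈ S a} = ∏ a, μ (g a) (S a) := by
  have hindep := (ProbabilityTheory.iIndepFun_pi (μ := μ) (X := fun i => (id : X i → X i))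
    fun i => aemeasurable_id).precomp hg
  rw [Set.ofPred_forall]
  refine (hindep.meas_iInter fun a => ⟨S a, hS a, rfl⟩).trans (Finset.prod_congr rfl fun a _ => ?_)
  exact (measurePreserving_eval μ (g a)).measure_preimage (hS a).nullMeasurableSet

theorem measureReal_pi_inter_mul_pow_le {ι κ κ' X : Type*} [Fintype ι] [Fintype κ] [Fintype κ']
    [MeasurableSpace X] (ν : Measure X) [IsProbabilityMeasure ν] {g : κ → ι} {g' : κ' → ι}
    (hg : Function.Injective g) (hg' : Function.Injective g') {S : κ → Set X} {S' : κ' → Set X}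
    (hS : ∀ a, MeasurableSet (S a)) (hS' : ∀ a, MeasurableSet (S' a)) {s : ℝ}
    (hs : ∀ a, ν.real (S a) = s) (hs' : ∀ a, ν.real (S' a) = s) :
    (Measure.pi fun _ : ι => ν).real ({ω | ∀ a, ω (g a) ∈ S a} ∩ {ω | ∀ a, ω (g' a) ∈ S' a}) *
        s ^ (g' ⁻¹' Set.range g).ncard ≤
      s ^ Fintype.card κ * s ^ Fintype.card κ' := by
  classical
  let fresh : Set κ' := (g' ⁻¹' Set.range g)ᶜ
  let coord : κ ⊕ fresh → ι := Sum.elim g fun a => g' a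
  let T : κ ⊕ fresh → Set X := Sum.elim S fun a => S' a
  have coord_injective : Function.Injective coord :=
    hg.sumElim (hg'.comp Subtype.val_injective) fun a b hab => b.2 ⟨a, hab⟩
  have hT (a : κ ⊕ fresh) : MeasurableSet (T a) := by cases a <;> simp [T, hS, hS']
  have hTs (a : κ ⊕ fresh) : (ν (T a)).toReal = s := by
    cases a <;> simp [T, ← measureReal_def, hs, hs']
  have hsub : ({ω | ∀ a, ω (g a) ∈ S a} ∩ {ω | ∀ a, ω (g' a) ∈ S' a} : Set (ι → X)) ⊆
      {ω | ∀ a, ω (coord a) ∈ T a} := by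
    rintro ω ⟨hω, hω'⟩ (a | a)
    · exact hω a
    · exact hω' a
  have hcard : Fintype.card κ' = Fintype.card fresh + (g' ⁻¹' Set.range g).ncard := by
    rw [← Nat.card_eq_fintype_card, ← Nat.card_eq_fintype_card, Nat.card_coe_set_eq, add_comm,
      Set.ncard_add_ncard_compl]
  have hs_nonneg : 0 ≤ s ^ (g' ⁻¹' Set.range g).ncard := by
    rcases isEmpty_or_nonempty κ' with _ | ⟨⟨a⟩⟩
    · simp [Set.eq_empty_of_isEmpty]
    · exact pow_nonneg (hs' a ▸ measureReal_nonneg) _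
  calc _ ≤ (Measure.pi fun _ : ι => ν).real {ω | ∀ a, ω (coord a) ∈ T a} *
        s ^ (g' ⁻¹' Set.range g).ncard := by
        gcongr
        exact measure_ne_top _ _
    _ = s ^ Fintype.card κ * s ^ Fintype.card κ' := by
      rw [measureReal_def, measure_pi_forall_mem (fun _ => ν) coord_injective hT,
        ENNReal.toReal_prod, Finset.prod_congr rfl fun a _ => hTs a, Finset.prod_const,
        Finset.card_univ, Fintype.card_sum, hcard, pow_add, pow_add, mul_assoc]

theorem tendsto_measure_one_of_tendsto_measure_compl_zero {α : Type*} {l : Filter α}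
    {Ω : α → Type*} [∀ a, MeasurableSpace (Ω a)] {μ : ∀ a, Measure (Ω a)}
    [∀ a, IsProbabilityMeasure (μ a)] {A : ∀ a, Set (Ω a)}
    (h : Tendsto (fun a => μ a (A a)ᶜ) l (𝓝 0)) : Tendsto (fun a => μ a (A a)) l (𝓝 1) := by
  have hlow : Tendsto (fun a => 1 - μ a (A a)ᶜ) l (𝓝 1) := by
    simpa using ENNReal.Tendsto.sub tendsto_const_nhds h (Or.inl ENNReal.one_ne_top)
  refine tendsto_of_tendsto_of_tendsto_of_le_of_le hlow tendsto_const_nhds (fun a => ?_)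
    fun a => prob_le_one
  rw [tsub_le_iff_right, ← measure_univ (μ := μ a), ← Set.union_compl_self (A a)]
  exact measure_union_le _ _

theorem sum_embedding_pow_ncard_preimage_le (V W : Type*) [Fintype V] [Fintype W]
    (R : Set V) {x : ℝ} (hx : 0 ≤ x) :
    ∑ φ : W ↪ V, x ^ (φ ⁻¹' R).ncard ≤
      (R.ncard * x + Fintype.card V) ^ Fintype.card W := by
  classical
  let weight (y : V) : ℝ := if y ∈ R then x else 1
  have weight_nonneg (y : V) : 0 ≤ weight y := by
    simp only [weight]
    positivity
  have pow_eq_prod_weight (φ : W ↪ V) : x ^ (φ ⁻¹' R).ncard = ∏ w, weight (φ w) := by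
    simp [weight, Finset.prod_ite, Set.ncard_eq_toFinset_card']
  have sum_weight_le : ∑ y, weight y ≤ R.ncard * x + Fintype.card V := by
    calc ∑ y, weight y ≤ ∑ y, ((if y ∈ R then x else 0) + 1) := by
          refine Finset.sum_le_sum fun y _ => ?_
          simp only [weight]
          split_ifs <;> linarith
      _ = R.ncard * x + Fintype.card V := by
          simp [Finset.sum_add_distrib, Finset.sum_ite, Set.ncard_eq_toFinset_card']
  calc ∑ φ : W ↪ V, x ^ (φ ⁻¹' R).ncard
      = ∑ f ∈ Finset.univ.map ⟨fun φ : W ↪ V => (φ : W → V), DFunLike.coe_injective⟩,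
          ∏ w, weight (f w) := by simp [pow_eq_prod_weight]
    _ ≤ ∑ f : W → V, ∏ w, weight (f w) :=
        Finset.sum_le_sum_of_subset_of_nonneg (Finset.subset_univ _) fun f _ _ =>
          Finset.prod_nonneg fun w _ => weight_nonneg (f w)
    _ = (∑ y, weight y) ^ Fintype.card W := by
        rw [← Fintype.piFinset_univ, ← Finset.prod_univ_sum, Finset.prod_const, Finset.card_univ]
    _ ≤ _ := pow_le_pow_left₀ (Finset.sum_nonneg fun y _ => weight_nonneg y) sum_weight_le _

theorem exists_lt_card_strictMono {α : Type*} [Finite α] (P : α → α → Prop) [IsStrictOrder α P] :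
    ∃ σ : α → ℕ, (∀ a, σ a < Nat.card α) ∧ ∀ a b, P a b → σ a < σ b := by
  refine ⟨fun a => {c | P c a}.ncard, fun a => ?_, fun a b hab => ?_⟩
  · exact Set.ncard_lt_card ((Set.ne_univ_iff_exists_notMem _).2 ⟨a, irrefl_of P a⟩)
  · exact Set.ncard_lt_ncard ⟨fun c hca => trans_of P hca hab, fun h => irrefl_of P a (h hab)⟩

theorem exists_forall_mem_Ico_zsmul {ι : Type*} [Finite ι] [Nonempty ι] {δ : ℝ} (hδ : 0 < δ)
    (l : ι → ℝ) (hl : ∀ i j, l i - l j < δ) :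
    ∃ k : ℤ, ∀ i, l i ∈ Set.Ico (k • δ) ((k + 2) • δ) := by
  obtain ⟨i₀, hmin⟩ := Finite.exists_min l
  obtain ⟨k, ⟨hk, hk'⟩, -⟩ := existsUnique_zsmul_near_of_pos hδ (l i₀)
  refine ⟨k, fun i => ⟨hk.trans (hmin i), ?_⟩⟩
  simp only [add_smul, one_smul, two_smul] at hk' ⊢
  linarith [hl i i₀]

theorem tsum_measure_Ico_zsmul (μ : Measure ℝ) {δ : ℝ} (hδ : 0 < δ) :
    ∑' k : ℤ, μ (Set.Ico (k • δ) ((k + 2) • δ)) = 2 * μ Set.univ := by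
  have tsum_cell (a : ℝ) : ∑' k : ℤ, μ (Set.Ico (a + k • δ) (a + (k + 1) • δ)) = μ Set.univ := by
    rw [← measure_iUnion (Set.pairwise_disjoint_Ico_add_zsmul a δ) fun k => measurableSet_Ico,
      iUnion_Ico_add_zsmul hδ]
  have window_eq (k : ℤ) : μ (Set.Ico (k • δ) ((k + 2) • δ)) =
      μ (Set.Ico (0 + k • δ) (0 + (k + 1) • δ)) + μ (Set.Ico (δ + k • δ) (δ + (k + 1) • δ)) := by
    have h0 : 0 + (k + 1) • δ = δ + k • δ := by simp [add_smul, add_comm]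
    have h1 : δ + (k + 1) • δ = (k + 2) • δ := by simp [add_smul, two_smul]; ring
    rw [h0, h1, ← measure_union Set.Ico_disjoint_Ico_same measurableSet_Ico, zero_add,
      Set.Ico_union_Ico_eq_Ico] <;> simp [add_smul, two_smul] <;> linarith
  simp only [window_eq, ENNReal.tsum_add, tsum_cell, two_mul]

section Motif

variable {V W W' : Type*} {H : SimpleGraph W} {H' : SimpleGraph W'}
  {P : H.edgeSet → H.edgeSet → Prop} {δ : ℝ}

theorem TemporalGraph.containsMotif_iff {G : TemporalGraph V} :
    G.ContainsMotif H P δ ↔ ∃ (c : H.Copy G.footprint) (l : H.edgeSet → ℝ),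
      (∀ e : H.edgeSet, l e ∈ G.labels (Sym2.map c e)) ∧ (∀ e f, P e f → l e < l f) ∧
        ∀ e f, l e - l f < δ := by
  constructor
  · rintro ⟨I, l, φ, hl, hP, hδ⟩
    have hmem (e : H.edgeSet) : Sym2.map (fun w => (φ w : V)) e ∈ I.edgeSet := by
      obtain ⟨e, he⟩ := e
      induction e with
      | _ a b => exact φ.map_adj_iff.2 he
    exact ⟨I.coeCopy.comp φ.toCopy, fun e => l (Sym2.map (fun w => (φ w : V)) e),
      fun e => hl _ (hmem e), hP, fun e f => hδ _ (hmem e) _ (hmem f)⟩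
  · rintro ⟨c, l, hl, hP, hδ⟩
    let image (e : H.edgeSet) : Sym2 V := Sym2.map c e
    have image_injective : Function.Injective image :=
      (Sym2.map.injective c.injective).comp Subtype.val_injective
    have exists_image_eq : ∀ e ∈ c.toSubgraph.edgeSet, ∃ f, image f = e := by
      intro e he
      induction e with
      | _ x y =>
        obtain ⟨a, b, hab, rfl, rfl⟩ := he
        exact ⟨⟨s(a, b), by simpa using hab⟩, rfl⟩
    refine ⟨c.toSubgraph, Function.extend image l 0, c.isoToSubgraph, fun e he => ?_,
      fun e f hef => ?_, fun e he f hf => ?_⟩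
    · obtain ⟨e, rfl⟩ := exists_image_eq e he
      exact (image_injective.extend_apply l 0 e).symm ▸ hl e
    · change Function.extend image l 0 (image e) < Function.extend image l 0 (image f)
      rw [image_injective.extend_apply, image_injective.extend_apply]
      exact hP e f hef
    · obtain ⟨e, rfl⟩ := exists_image_eq e he
      obtain ⟨f, rfl⟩ := exists_image_eq f hf
      rw [image_injective.extend_apply, image_injective.extend_apply]
      exact hδ e f

theorem TemporalGraph.ContainsMotif.comap {G : TemporalGraph V} (h : G.ContainsMotif H P δ)
    (c : H'.Copy H) : G.ContainsMotif H' (InvImage P c.toHom.mapEdgeSet) δ := by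
  obtain ⟨d, l, hl, hP, hδ⟩ := containsMotif_iff.1 h
  refine containsMotif_iff.2 ⟨d.comp c, l ∘ c.toHom.mapEdgeSet, fun e => ?_,
    fun e f hef => hP _ _ hef, fun e f => hδ _ _⟩
  simpa [Sym2.map_map, Function.comp_def] using hl (c.toHom.mapEdgeSet e)

theorem TemporalGraph.ContainsMotif.pos [Nonempty H.edgeSet] {G : TemporalGraph V}
    (h : G.ContainsMotif H P δ) : 0 < δ := by
  obtain ⟨-, l, -, -, hδ⟩ := containsMotif_iff.1 h
  obtain ⟨e⟩ := ‹Nonempty H.edgeSet›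
  simpa using hδ e e

/-- The image of an edge under an injective map of the vertices. -/
def edgeImage (φ : W ↪ V) (e : H.edgeSet) : PotentialEdge V :=
  ⟨Sym2.map φ e, fun h => H.not_isDiag_of_mem_edgeSet e.2 ((Sym2.isDiag_map φ.injective).1 h)⟩

theorem edgeImage_injective (φ : W ↪ V) : Function.Injective (edgeImage (H := H) φ) :=
  fun _ _ h => Subtype.ext (Sym2.map.injective φ.injective (congrArg Subtype.val h))

theorem sampledGraph_containsMotif_iff {ω : LabelSpace V} :
    (sampledGraph ω).ContainsMotif H P δ ↔ ∃ (φ : W ↪ V) (l : H.edgeSet → ℝ),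
      (∀ e, ∃ i < (ω (edgeImage φ e)).1, (ω (edgeImage φ e)).2 i = l e) ∧
        (∀ e f, P e f → l e < l f) ∧ ∀ e f, l e - l f < δ := by
  rw [TemporalGraph.containsMotif_iff]
  constructor
  · rintro ⟨c, l, hl, hP, hδ⟩
    exact ⟨c.toEmbedding, l, fun e => (hl e).2, hP, hδ⟩
  · rintro ⟨φ, l, hl, hP, hδ⟩
    have hlabels (e : H.edgeSet) : l e ∈ sampledLabels ω (Sym2.map φ e) :=
      ⟨(edgeImage φ e).2, hl e⟩
    have hadj {a b : W} (hab : H.Adj a b) : (sampledGraph ω).footprint.Adj (φ a) (φ b) :=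
      (SimpleGraph.fromEdgeSet_adj _).2 ⟨⟨_, hlabels ⟨s(a, b), hab⟩⟩, φ.injective.ne hab.ne⟩
    exact ⟨⟨⟨φ, hadj⟩, φ.injective⟩, l, hlabels, hP, hδ⟩

end Motif

section EdgeLaw

/-- The first moment of a label multiplicity distribution. -/
noncomputable def meanMultiplicity (ψ : PMF ℕ) : ENNReal :=
  ∑' k : ℕ, ψ k * (k : ENNReal)

/-- The law of the number of labels and of the candidate labels of a single potential edge. -/
noncomputable def edgeLaw (ψ : PMF ℕ) : Measure (ℕ × (ℕ → ℝ)) :=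
  ψ.toMeasure.prod (Measure.infinitePi fun _ : ℕ => unifIoc)

variable (ψ : PMF ℕ)

instance edgeLaw_isProbabilityMeasure : IsProbabilityMeasure (edgeLaw ψ) := by
  unfold edgeLaw; infer_instance

theorem labelMeasure_eq_pi_edgeLaw (V : Type*) [Fintype V] [DecidableEq V] :
    labelMeasure V ψ = Measure.pi fun _ => edgeLaw ψ := rfl

instance labelMeasure_isProbabilityMeasure (V : Type*) [Fintype V] [DecidableEq V] :
    IsProbabilityMeasure (labelMeasure V ψ) := by
  rw [labelMeasure_eq_pi_edgeLaw]; infer_instance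

theorem edgeLaw_candidate_mem (i : ℕ) {B : Set ℝ} (hB : MeasurableSet B) :
    edgeLaw ψ {z | i < z.1 ∧ z.2 i ∈ B} = ψ.toMeasure {l | i < l} * unifIoc B := by
  rw [← (measurePreserving_eval_infinitePi (fun _ : ℕ => unifIoc) i).measure_preimage
    hB.nullMeasurableSet]
  exact Measure.prod_prod {l | i < l} ((fun x : ℕ → ℝ => x i) ⁻¹' B)

theorem measurableSet_candidate_mem (i : ℕ) {B : Set ℝ} (hB : MeasurableSet B) :
    MeasurableSet {z : ℕ × (ℕ → ℝ) | i < z.1 ∧ z.2 i ∈ B} :=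
  (MeasurableSet.of_discrete (s := {l : ℕ | i < l})).prod (measurable_pi_apply i hB)

theorem tsum_toMeasure_lt : ∑' i : ℕ, ψ.toMeasure {l | i < l} = meanMultiplicity ψ := by
  have toMeasure_lt (i : ℕ) : ψ.toMeasure {l | i < l} = ∑' k, if i < k then ψ k else 0 := by
    simp [PMF.toMeasure_apply, Set.indicator_apply]
  simp_rw [toMeasure_lt]
  rw [ENNReal.tsum_comm]
  refine tsum_congr fun k => ?_
  rw [tsum_eq_sum (s := Finset.range k) fun i hi => if_neg (by simpa using hi),
    Finset.sum_congr rfl fun i hi => if_pos (Finset.mem_range.1 hi)]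
  simp [mul_comm]

theorem edgeLaw_exists_label_mem_le {B : Set ℝ} (hB : MeasurableSet B) :
    edgeLaw ψ {z | ∃ i < z.1, z.2 i ∈ B} ≤ meanMultiplicity ψ * unifIoc B := by
  have eq_iUnion : {z : ℕ × (ℕ → ℝ) | ∃ i < z.1, z.2 i ∈ B} =
      ⋃ i, {z | i < z.1 ∧ z.2 i ∈ B} := by
    ext z; simp
  rw [eq_iUnion, ← tsum_toMeasure_lt, ← ENNReal.tsum_mul_right]
  exact (measure_iUnion_le _).trans_eq (tsum_congr fun i => edgeLaw_candidate_mem ψ i hB)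

theorem measurableSet_exists_label_mem {B : Set ℝ} (hB : MeasurableSet B) :
    MeasurableSet {z : ℕ × (ℕ → ℝ) | ∃ i < z.1, z.2 i ∈ B} := by
  rw [Set.ofPred_exists]
  exact MeasurableSet.iUnion fun i => measurableSet_candidate_mem i hB

theorem toMeasure_pos_of_meanMultiplicity_pos {ψ : PMF ℕ} (h : 0 < meanMultiplicity ψ) :
    0 < ψ.toMeasure {l | 0 < l} := by
  rw [← tsum_toMeasure_lt, pos_iff_ne_zero, Ne, ENNReal.tsum_eq_zero, not_forall] at h
  obtain ⟨i, hi⟩ := h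
  exact (pos_iff_ne_zero.2 hi).trans_le (measure_mono fun l hl => (Nat.zero_le i).trans_lt hl)

end EdgeLaw

section PlacedCopy

variable {V W X : Type*} {H : SimpleGraph W}

/-- The event that the copy of `H` on the image of `φ` has, for each edge `e` of `H`, its image
decorated by an element of `S e`. -/
def placedCopy (S : H.edgeSet → Set X) (φ : W ↪ V) : Set (PotentialEdge V → X) :=
  {ω | ∀ e, ω (edgeImage φ e) ∈ S e}

variable [MeasurableSpace X] {S : H.edgeSet → Set X}

theorem measurableSet_placedCopy [Finite W] (hS : ∀ e, MeasurableSet (S e)) (φ : W ↪ V) :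
    MeasurableSet (placedCopy S φ) := by
  rw [placedCopy, Set.ofPred_forall]
  exact MeasurableSet.iInter fun e => measurable_pi_apply (edgeImage φ e) (hS e)

theorem measure_placedCopy [Fintype (PotentialEdge V)] [Fintype H.edgeSet] (ν : Measure X)
    [IsProbabilityMeasure ν] (hS : ∀ e, MeasurableSet (S e)) (φ : W ↪ V) :
    Measure.pi (fun _ => ν) (placedCopy S φ) = ∏ e, ν (S e) :=
  measure_pi_forall_mem (fun _ => ν) (edgeImage_injective φ) hS

end PlacedCopy

section Sparsity

variable {W : Type*} {H : SimpleGraph W}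

theorem ncard_verts_pos_of_ncard_edgeSet_pos [Finite W] {J : H.Subgraph}
    (hJ : 0 < J.edgeSet.ncard) : 0 < J.verts.ncard := by
  obtain ⟨e, he⟩ := Set.nonempty_of_ncard_ne_zero hJ.ne'
  induction e with
  | _ a b => exact (Set.ncard_pos (Set.toFinite _)).2 ⟨a, J.edge_vert he⟩

theorem ncard_edgeSet_coe (J : H.Subgraph) : J.coe.edgeSet.ncard = J.edgeSet.ncard := by
  rw [← SimpleGraph.Subgraph.image_coe_edgeSet_coe,
    Set.ncard_image_of_injective _ (Sym2.map.injective Subtype.val_injective)]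

theorem exists_subgraph_ncard_verts_eq_sparsity_mul [Finite W] (hH : 2 ≤ H.edgeSet.ncard) :
    ∃ (I : H.Subgraph) (r : ℕ), r ≠ 0 ∧ I.edgeSet.ncard = r + 1 ∧
      (I.verts.ncard : ℝ) = sparsity H * r := by
  obtain ⟨I, hI, hρ⟩ := (sparsity_isLeast H hH).1
  obtain ⟨r, hr⟩ : ∃ r, I.edgeSet.ncard = r + 1 := ⟨I.edgeSet.ncard - 1, by omega⟩
  have hr0 : r ≠ 0 := by omega
  refine ⟨I, r, hr0, hr, ?_⟩
  rw [hρ, hr, Nat.cast_add_one, add_sub_cancel_right, div_mul_cancel₀ _ (Nat.cast_ne_zero.2 hr0)]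

theorem sparsity_pos [Finite W] (hH : 2 ≤ H.edgeSet.ncard) : 0 < sparsity H := by
  obtain ⟨I, r, -, hr, hv⟩ := exists_subgraph_ncard_verts_eq_sparsity_mul hH
  have hv_pos : (0 : ℝ) < I.verts.ncard :=
    Nat.cast_pos.2 (ncard_verts_pos_of_ncard_edgeSet_pos (by omega))
  exact pos_of_mul_pos_left (hv ▸ hv_pos) r.cast_nonneg

theorem sparsity_mul_le_ncard_verts [Finite W] (J : H.Subgraph) {r : ℕ}
    (hr : J.edgeSet.ncard = r + 1) : sparsity H * r ≤ J.verts.ncard := by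
  rcases r.eq_zero_or_pos with rfl | hr0
  · simp
  have hJ : 2 ≤ J.edgeSet.ncard := by omega
  have hH : 2 ≤ H.edgeSet.ncard := hJ.trans (Set.ncard_le_ncard J.edgeSet_subset)
  have hle := (sparsity_isLeast H hH).2 ⟨J, hJ, rfl⟩
  rwa [hr, Nat.cast_add_one, add_sub_cancel_right, le_div_iff₀ (Nat.cast_pos.2 hr0)] at hle

end Sparsity

section FirstMoment

theorem tsum_unifIoc_Ico_zsmul_pow_le {δ : ℝ} (hδ : 0 < δ) (r : ℕ) :
    ∑' k : ℤ, unifIoc (Set.Ico (k • δ) ((k + 2) • δ)) ^ (r + 1) ≤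
      2 * ENNReal.ofReal (2 * δ) ^ r := by
  have window_le (k : ℤ) :
      unifIoc (Set.Ico (k • δ) ((k + 2) • δ)) ≤ ENNReal.ofReal (2 * δ) := by
    refine (Measure.restrict_le_self _).trans_eq ?_
    rw [Real.volume_Ico, add_smul, add_sub_cancel_left, two_smul, two_mul]
  calc ∑' k : ℤ, unifIoc (Set.Ico (k • δ) ((k + 2) • δ)) ^ (r + 1)
      ≤ ∑' k : ℤ, ENNReal.ofReal (2 * δ) ^ r * unifIoc (Set.Ico (k • δ) ((k + 2) • δ)) := by
        refine ENNReal.tsum_le_tsum fun k => ?_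
        rw [pow_succ]
        gcongr
        exact window_le k
    _ = 2 * ENNReal.ofReal (2 * δ) ^ r := by
        rw [ENNReal.tsum_mul_left, tsum_measure_Ico_zsmul _ hδ, measure_univ, mul_one, mul_comm]

theorem measure_placedCopy_exists_label_mem_le {V W : Type*} [Fintype V] [DecidableEq V]
    [Finite W] {H : SimpleGraph W} (ψ : PMF ℕ) {B : Set ℝ} (hB : MeasurableSet B) (φ : W ↪ V) :
    labelMeasure V ψ (placedCopy (H := H) (fun _ => {z | ∃ i < z.1, z.2 i ∈ B}) φ) ≤
      (meanMultiplicity ψ * unifIoc B) ^ H.edgeSet.ncard := by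
  have := Fintype.ofFinite H.edgeSet
  rw [labelMeasure_eq_pi_edgeLaw, measure_placedCopy _ fun _ => measurableSet_exists_label_mem hB,
    Finset.prod_const, Finset.card_univ, ← Nat.card_eq_fintype_card, Nat.card_coe_set_eq]
  gcongr
  exact edgeLaw_exists_label_mem_le ψ hB

theorem labelMeasure_containsMotif_le {V W : Type*} [Fintype V] [DecidableEq V] [Fintype W]
    {H : SimpleGraph W} (P : H.edgeSet → H.edgeSet → Prop) (ψ : PMF ℕ) (δ : ℝ) {r : ℕ}
    (hr : H.edgeSet.ncard = r + 1) :
    labelMeasure V ψ {ω | (sampledGraph ω).ContainsMotif H P δ} ≤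
      Fintype.card V ^ Fintype.card W *
        (meanMultiplicity ψ ^ (r + 1) * (2 * ENNReal.ofReal (2 * δ) ^ r)) := by
  have : Nonempty H.edgeSet := (Set.nonempty_of_ncard_ne_zero (by omega)).to_subtype
  let window (k : ℤ) : Set ℝ := Set.Ico (k • δ) ((k + 2) • δ)
  rcases le_or_gt δ 0 with hδ | hδ
  · have h_empty : {ω : LabelSpace V | (sampledGraph ω).ContainsMotif H P δ} = ∅ :=
      Set.eq_empty_of_forall_notMem fun ω hω => hω.pos.not_ge hδ
    simp [h_empty]
  have hsub : {ω : LabelSpace V | (sampledGraph ω).ContainsMotif H P δ} ⊆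
      ⋃ (φ : W ↪ V) (k : ℤ),
        placedCopy (H := H) (fun _ => {z | ∃ i < z.1, z.2 i ∈ window k}) φ := by
    intro ω hω
    obtain ⟨φ, l, hmem, -, hl⟩ := sampledGraph_containsMotif_iff.1 hω
    obtain ⟨k, hk⟩ := exists_forall_mem_Ico_zsmul hδ l hl
    refine Set.mem_iUnion₂.2 ⟨φ, k, fun e => ?_⟩
    obtain ⟨i, hi, hil⟩ := hmem e
    exact ⟨i, hi, hil ▸ hk e⟩
  calc _ ≤ ∑ _φ : W ↪ V, ∑' k : ℤ, (meanMultiplicity ψ * unifIoc (window k)) ^ (r + 1) := by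
        refine (measure_mono hsub).trans ((measure_iUnion_fintype_le _ _).trans ?_)
        refine Finset.sum_le_sum fun _ _ => (measure_iUnion_le _).trans ?_
        rw [← hr]
        exact ENNReal.tsum_le_tsum fun k =>
          measure_placedCopy_exists_label_mem_le ψ measurableSet_Ico _
    _ ≤ _ := by
        simp only [mul_pow, ENNReal.tsum_mul_left, Finset.sum_const, Finset.card_univ,
          nsmul_eq_mul, Fintype.card_embedding_eq]
        gcongr
        · exact_mod_cast Nat.descFactorial_le_pow _ _
        · exact tsum_unifIoc_Ico_zsmul_pow_le hδ r

theorem natCast_pow_mul_ofReal_pow {n v r : ℕ} (hn : n ≠ 0) {ρ : ℝ} (hv : (v : ℝ) = ρ * r)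
    (x : ℝ) : (n : ENNReal) ^ v * ENNReal.ofReal x ^ r =
      ENNReal.ofReal (x / (n : ℝ) ^ (-ρ)) ^ r := by
  have hpow : (n : ENNReal) ^ v = ENNReal.ofReal ((n : ℝ) ^ ρ) ^ r := by
    rw [← ENNReal.ofReal_natCast, ← ENNReal.ofReal_pow n.cast_nonneg,
      ← ENNReal.ofReal_pow (by positivity), ← Real.rpow_natCast, ← Real.rpow_mul_natCast
        n.cast_nonneg, hv]
  rw [hpow, ← mul_pow, ← ENNReal.ofReal_mul (by positivity), Real.rpow_neg n.cast_nonneg,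
    div_inv_eq_mul, mul_comm]

theorem tendsto_not_containsMotif {W : Type*} [Finite W] (H : SimpleGraph W)
    (hH : 2 ≤ H.edgeSet.ncard) (P : H.edgeSet → H.edgeSet → Prop) (ψ : PMF ℕ)
    (hψ : meanMultiplicity ψ < ⊤) (δ : ℕ → ℝ)
    (hδ : δ =o[atTop] (fun n : ℕ => (n : ℝ) ^ (-sparsity H))) :
    Tendsto (fun n : ℕ => labelMeasure (Fin n) ψ
      {ω | ¬ (sampledGraph ω).ContainsMotif H P (δ n)}) atTop (𝓝 1) := by
  obtain ⟨I, r, hr0, hr, hv⟩ := exists_subgraph_ncard_verts_eq_sparsity_mul hH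
  have := Fintype.ofFinite I.verts
  rw [← Nat.card_coe_set_eq, Nat.card_eq_fintype_card] at hv
  set C : ENNReal := meanMultiplicity ψ ^ (r + 1) * 2 with hC
  have hbound : ∀ᶠ n : ℕ in atTop, labelMeasure (Fin n) ψ
      {ω | ¬ (sampledGraph ω).ContainsMotif H P (δ n)}ᶜ ≤
        C * ENNReal.ofReal (2 * (δ n / (n : ℝ) ^ (-sparsity H))) ^ r := by
    filter_upwards [eventually_ne_atTop 0] with n hn
    rw [← mul_div_assoc, ← natCast_pow_mul_ofReal_pow hn hv]
    refine (measure_mono fun ω hω => (not_not.1 hω).comap I.coeCopy).trans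
      ((labelMeasure_containsMotif_le _ ψ _ ((ncard_edgeSet_coe I).trans hr)).trans_eq ?_)
    rw [Fintype.card_fin, hC]
    ring
  have hlim : Tendsto (fun n : ℕ => C * ENNReal.ofReal (2 * (δ n / (n : ℝ) ^ (-sparsity H))) ^ r)
      atTop (𝓝 0) := by
    have h := ENNReal.Tendsto.const_mul (a := C) (ENNReal.Tendsto.pow (n := r)
      (ENNReal.tendsto_ofReal (hδ.tendsto_div_nhds_zero.const_mul 2))) (Or.inr (by finiteness))
    simpa [hr0] using h
  exact tendsto_measure_one_of_tendsto_measure_compl_zero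
    (tendsto_of_tendsto_of_tendsto_of_le_of_le' tendsto_const_nhds hlim
      (Eventually.of_forall fun _ => zero_le) hbound)

end FirstMoment

section Overlap

variable {V W : Type*} {H : SimpleGraph W}

/-- The part of `H` that the copy of `H` given by `φ'` shares with the copy given by `φ`. -/
def overlapSubgraph (H : SimpleGraph W) (φ φ' : W ↪ V) : H.Subgraph where
  verts := φ' ⁻¹' Set.range φ
  Adj a b := H.Adj a b ∧ (H.map φ).Adj (φ' a) (φ' b)
  adj_sub h := h.1
  edge_vert := by
    rintro a b ⟨-, -, c, d, -, hc, -⟩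
    exact ⟨c, hc⟩
  symm := ⟨fun _ _ h => ⟨h.1.symm, h.2.symm⟩⟩

theorem ncard_edgeSet_overlapSubgraph (φ φ' : W ↪ V) :
    (overlapSubgraph H φ φ').edgeSet.ncard =
      (edgeImage (H := H) φ' ⁻¹' Set.range (edgeImage (H := H) φ)).ncard := by
  rw [← Set.ncard_image_of_injective _ Subtype.val_injective]
  congr 1
  ext e
  induction e with
  | _ a b =>
    constructor
    · rintro ⟨hab, -, c, d, hcd, hc, hd⟩
      exact ⟨⟨s(a, b), hab⟩, ⟨⟨s(c, d), hcd⟩, Subtype.ext (congrArg₂ Sym2.mk hc hd)⟩, rfl⟩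
    · rintro ⟨⟨e, hab⟩, ⟨⟨f, hf⟩, hfe⟩, rfl⟩
      refine ⟨hab, ?_⟩
      rw [← SimpleGraph.mem_edgeSet, SimpleGraph.edgeSet_map]
      exact ⟨f, hf, congrArg Subtype.val hfe⟩

theorem pow_le_mul_pow_ncard_verts [Finite W] (J : H.Subgraph) {r : ℕ}
    (hr : J.edgeSet.ncard = r + 1) {x y : ℝ} (hx : 0 ≤ x) (hy : 1 ≤ y)
    (hxy : x ≤ y ^ sparsity H) :
    x ^ r ≤ (1 / y + x / y ^ sparsity H) * y ^ J.verts.ncard := by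
  have hyρ : 0 < y ^ sparsity H := by positivity
  rcases eq_or_ne r 0 with rfl | hr0
  · have hv : J.verts.ncard ≠ 0 := (ncard_verts_pos_of_ncard_edgeSet_pos (by omega)).ne'
    calc x ^ 0 = 1 / y * y := by field_simp
      _ ≤ (1 / y + x / y ^ sparsity H) * y ^ J.verts.ncard := by
        gcongr
        · exact le_add_of_nonneg_right (by positivity)
        · exact le_self_pow₀ hy hv
  · have hpow : (y ^ sparsity H) ^ r ≤ y ^ J.verts.ncard := by
      rw [← Real.rpow_mul_natCast (by positivity), ← Real.rpow_natCast y]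
      exact Real.rpow_le_rpow_of_exponent_le hy (sparsity_mul_le_ncard_verts J hr)
    calc x ^ r = (x / y ^ sparsity H) ^ r * (y ^ sparsity H) ^ r := by
          rw [← mul_pow, div_mul_cancel₀ _ hyρ.ne']
      _ ≤ (1 / y + x / y ^ sparsity H) * y ^ J.verts.ncard := by
          gcongr
          refine (pow_le_of_le_one (by positivity) ((div_le_one hyρ).2 hxy) hr0).trans ?_
          exact le_add_of_nonneg_left (by positivity)

theorem half_pow_le_card_embedding [Fintype V] [Fintype W]
    (h : 2 * Fintype.card W ≤ Fintype.card V) :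
    ((Fintype.card V : ℝ) / 2) ^ Fintype.card W ≤ Fintype.card (W ↪ V) := by
  have hhalf : (Fintype.card V : ℝ) / 2 ≤ (Fintype.card V + 1 - Fintype.card W : ℕ) := by
    rw [Nat.cast_sub (by omega), div_le_iff₀ two_pos]
    have : (2 : ℝ) * Fintype.card W ≤ Fintype.card V := mod_cast h
    push_cast
    linarith
  rw [Fintype.card_embedding_eq]
  exact (pow_le_pow_left₀ (by positivity) hhalf _).trans
    (mod_cast Nat.pow_sub_le_descFactorial _ _)

end Overlap

section SecondMoment

/-- A family of disjoint windows, indexed by `κ`, each of which offers to every `a : α` a slot of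
the same probability `s = 1 / (|κ| * b)`. -/
structure IsSlotFamily {κ α X : Type*} [Fintype κ] [MeasurableSpace X] (ν : Measure X)
    (S : κ → α → Set X) (s b : ℝ) : Prop where
  measurableSet (k : κ) (a : α) : MeasurableSet (S k a)
  disjoint {k k' : κ} (hk : k ≠ k') (a a' : α) : Disjoint (S k a) (S k' a')
  one_le : 1 ≤ b
  inv_eq : s⁻¹ = Fintype.card κ * b
  measureReal_eq (k : κ) (a : α) : ν.real (S k a) = s

variable {V W X κ : Type*} [Fintype V] [DecidableEq V] [Fintype κ]
  {H : SimpleGraph W} [MeasurableSpace X] {ν : Measure X} {S : κ → H.edgeSet → Set X} {s b : ℝ}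

theorem IsSlotFamily.pos [Nonempty κ] (h : IsSlotFamily ν S s b) : 0 < s := by
  have hb : 0 < b := zero_lt_one.trans_le h.one_le
  rw [← inv_pos, h.inv_eq]
  positivity

variable [IsProbabilityMeasure ν]

section Pairs

variable [Finite W]

theorem IsSlotFamily.measureReal_placedCopy (h : IsSlotFamily ν S s b) (k : κ) (φ : W ↪ V) :
    (Measure.pi fun _ => ν).real (placedCopy (S k) φ) =
      s ^ H.edgeSet.ncard := by
  have := Fintype.ofFinite H.edgeSet
  rw [measureReal_def, measure_placedCopy ν (h.measurableSet k), ENNReal.toReal_prod,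
    Finset.prod_congr rfl fun e _ => (measureReal_def _ _).symm.trans (h.measureReal_eq k e),
    Finset.prod_const, Finset.card_univ, ← Nat.card_eq_fintype_card, Nat.card_coe_set_eq]

theorem IsSlotFamily.measureReal_placedCopy_inter_mul_pow_le (h : IsSlotFamily ν S s b) (k k' : κ)
    (φ φ' : W ↪ V) :
    (Measure.pi fun _ => ν).real (placedCopy (S k) φ ∩ placedCopy (S k') φ') *
        s ^ (overlapSubgraph H φ φ').edgeSet.ncard ≤
      s ^ H.edgeSet.ncard * s ^ H.edgeSet.ncard := by
  have := Fintype.ofFinite H.edgeSet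
  rw [ncard_edgeSet_overlapSubgraph, ← Nat.card_coe_set_eq H.edgeSet, Nat.card_eq_fintype_card]
  exact measureReal_pi_inter_mul_pow_le ν (edgeImage_injective φ) (edgeImage_injective φ')
    (h.measurableSet k) (h.measurableSet k') (h.measureReal_eq k) (h.measureReal_eq k')

theorem IsSlotFamily.measureReal_placedCopy_inter_le_of_ne (h : IsSlotFamily ν S s b) {k k' : κ}
    (hk : k ≠ k') (φ φ' : W ↪ V) :
    (Measure.pi fun _ => ν).real (placedCopy (S k) φ ∩ placedCopy (S k') φ') ≤
      s ^ H.edgeSet.ncard * s ^ H.edgeSet.ncard := by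
  have hmul := h.measureReal_placedCopy_inter_mul_pow_le k k' φ φ'
  rcases Set.eq_empty_or_nonempty (edgeImage (H := H) φ' ⁻¹' Set.range (edgeImage φ))
    with hshared | ⟨e, f, hfe⟩
  · rwa [ncard_edgeSet_overlapSubgraph, hshared, Set.ncard_empty, pow_zero, mul_one] at hmul
  · have h_empty : placedCopy (S k) φ ∩ placedCopy (S k') φ' = ∅ :=
      Set.eq_empty_of_forall_notMem fun ω hω =>
        (h.disjoint hk f e).notMem_of_mem_left (hω.1 f) (hfe ▸ hω.2 e)
    rw [h_empty, measureReal_empty]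
    exact mul_self_nonneg _

theorem IsSlotFamily.measureReal_placedCopy_inter_sub_le (h : IsSlotFamily ν S s b) [Nonempty V]
    (hκ : (Fintype.card κ : ℝ) ≤ (Fintype.card V : ℝ) ^ sparsity H) (k : κ) (φ φ' : W ↪ V) :
    (Measure.pi fun _ => ν).real (placedCopy (S k) φ ∩ placedCopy (S k) φ') -
        s ^ H.edgeSet.ncard * s ^ H.edgeSet.ncard ≤
      s ^ H.edgeSet.ncard * s ^ H.edgeSet.ncard *
        (b ^ H.edgeSet.ncard * Fintype.card κ * (1 / Fintype.card V + Fintype.card κ /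
          (Fintype.card V : ℝ) ^ sparsity H)) *
        (Fintype.card V : ℝ) ^ (φ' ⁻¹' Set.range φ).ncard := by
  have hmul := h.measureReal_placedCopy_inter_mul_pow_le k k φ φ'
  set J := overlapSubgraph H φ φ'
  set K : ℝ := (Fintype.card κ : ℝ)
  set n : ℝ := (Fintype.card V : ℝ)
  set q : ℝ := s ^ H.edgeSet.ncard * s ^ H.edgeSet.ncard
  have hb := h.one_le
  have hK : 0 < K := Nat.cast_pos.2 (Fintype.card_pos_iff.2 ⟨k⟩)
  have hn : 1 ≤ n := Nat.one_le_cast.2 Fintype.card_pos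
  have hq0 : 0 ≤ q := mul_self_nonneg _
  rcases hJ : J.edgeSet.ncard with _ | r
  · rw [hJ, pow_zero, mul_one] at hmul
    exact (sub_nonpos.2 hmul).trans (by positivity)
  have hrm : r + 1 ≤ H.edgeSet.ncard := hJ ▸ Set.ncard_le_ncard J.edgeSet_subset
  have hKr := pow_le_mul_pow_ncard_verts J hJ hK.le hn hκ
  rw [hJ, ← div_inv_eq_mul, ← inv_pow, h.inv_eq, div_le_iff₀ (by positivity)] at hmul
  calc _ ≤ q * (K * b) ^ (r + 1) := (sub_le_self _ hq0).trans hmul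
    _ = q * (b ^ (r + 1) * K * K ^ r) := by ring
    _ ≤ q * (b ^ H.edgeSet.ncard * K * ((1 / n + K / n ^ sparsity H) * n ^ J.verts.ncard)) := by
      gcongr
    _ = _ := by
      simp only [mul_assoc]
      rfl

end Pairs

variable [Fintype W]

theorem IsSlotFamily.sum_measureReal_placedCopy_inter_sub_le (h : IsSlotFamily ν S s b) [Nonempty V]
    (hκ : (Fintype.card κ : ℝ) ≤ (Fintype.card V : ℝ) ^ sparsity H) (k : κ) (φ : W ↪ V) :
    ∑ y : (W ↪ V) × κ,
        ((Measure.pi fun _ => ν).real (placedCopy (S k) φ ∩ placedCopy (S y.2) y.1) -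
          s ^ H.edgeSet.ncard * s ^ H.edgeSet.ncard) ≤
      s ^ H.edgeSet.ncard * s ^ H.edgeSet.ncard *
        (b ^ H.edgeSet.ncard * Fintype.card κ * (1 / Fintype.card V + Fintype.card κ /
          (Fintype.card V : ℝ) ^ sparsity H)) *
        ((Fintype.card W + 1) * Fintype.card V) ^ Fintype.card W := by
  classical
  set q : ℝ :=
    s ^ H.edgeSet.ncard * s ^ H.edgeSet.ncard
  set c : ℝ := q * (b ^ H.edgeSet.ncard * Fintype.card κ * (1 / Fintype.card V +
    Fintype.card κ / (Fintype.card V : ℝ) ^ sparsity H))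
  have hc : 0 ≤ c := by
    have hb := h.one_le
    have : 0 ≤ q := mul_self_nonneg _
    positivity
  calc _ ≤ ∑ y : (W ↪ V) × κ,
        if k = y.2 then c * (Fintype.card V : ℝ) ^ (y.1 ⁻¹' Set.range φ).ncard else 0 := by
        refine Finset.sum_le_sum fun ⟨φ', k'⟩ _ => ?_
        split_ifs with hk
        · subst hk
          exact h.measureReal_placedCopy_inter_sub_le hκ k φ φ'
        · exact sub_nonpos.2 (h.measureReal_placedCopy_inter_le_of_ne hk φ φ')
    _ = c * ∑ φ' : W ↪ V, (Fintype.card V : ℝ) ^ (φ' ⁻¹' Set.range φ).ncard := by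
        simp [Fintype.sum_prod_type, Finset.mul_sum]
    _ ≤ c * ((Fintype.card W + 1) * Fintype.card V) ^ Fintype.card W := by
        have hrange : (Set.range φ).ncard = Fintype.card W := by
          rw [← Set.image_univ, Set.ncard_image_of_injective _ φ.injective, Set.ncard_univ,
            Nat.card_eq_fintype_card]
        have hsum := sum_embedding_pow_ncard_preimage_le V W (Set.range φ)
          (Nat.cast_nonneg (α := ℝ) (Fintype.card V))
        rw [hrange, ← add_one_mul] at hsum
        gcongr

theorem IsSlotFamily.measureReal_iInter_compl_placedCopy_le (h : IsSlotFamily ν S s b) [Nonempty V]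
    [Nonempty κ] (hV : 2 * Fintype.card W ≤ Fintype.card V)
    (hκ : (Fintype.card κ : ℝ) ≤ (Fintype.card V : ℝ) ^ sparsity H) :
    (Measure.pi fun _ => ν).real (⋂ x : (W ↪ V) × κ, (placedCopy (S x.2) x.1)ᶜ) ≤
      b ^ H.edgeSet.ncard * (2 * (Fintype.card W + 1)) ^ Fintype.card W *
        (1 / Fintype.card V + Fintype.card κ / (Fintype.card V : ℝ) ^ sparsity H) := by
  have hsecond := sq_sum_measureReal_mul_measureReal_iInter_compl_le
    (Measure.pi fun _ : PotentialEdge V => ν) (A := fun x : (W ↪ V) × κ => placedCopy (S x.2) x.1)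
    fun x => measurableSet_placedCopy (h.measurableSet x.2) x.1
  simp only [h.measureReal_placedCopy] at hsecond
  have hsum := hsecond.trans (Finset.sum_le_sum fun x _ =>
    h.sum_measureReal_placedCopy_inter_sub_le hκ x.2 x.1)
  simp only [Finset.sum_const, Finset.card_univ, Fintype.card_prod, nsmul_eq_mul,
    Nat.cast_mul] at hsum
  have hN := half_pow_le_card_embedding hV
  set K : ℝ := (Fintype.card κ : ℝ)
  set n : ℝ := (Fintype.card V : ℝ)
  set N : ℝ := (Fintype.card (W ↪ V) : ℝ)
  set t : ℝ := s ^ H.edgeSet.ncard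
  set θ : ℝ := 1 / n + K / n ^ sparsity H
  set p : ℝ := (Measure.pi fun _ : PotentialEdge V => ν).real
    (⋂ x : (W ↪ V) × κ, (placedCopy (S x.2) x.1)ᶜ)
  have : 0 < b := zero_lt_one.trans_le h.one_le
  have : 0 < s := h.pos
  have : 0 < K := Nat.cast_pos.2 Fintype.card_pos
  have : 0 < n := Nat.cast_pos.2 Fintype.card_pos
  have : 0 < N := lt_of_lt_of_le (by positivity) hN
  have hNp : N * p ≤ b ^ H.edgeSet.ncard * θ * ((Fintype.card W + 1) * n) ^ Fintype.card W := by
    refine le_of_mul_le_mul_left ?_ (show 0 < N * K ^ 2 * t ^ 2 by positivity)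
    linear_combination hsum
  refine le_of_mul_le_mul_left ?_ (show 0 < (n / 2) ^ Fintype.card W by positivity)
  calc (n / 2) ^ Fintype.card W * p
      ≤ N * p := by gcongr
    _ ≤ b ^ H.edgeSet.ncard * θ * ((Fintype.card W + 1) * n) ^ Fintype.card W := hNp
    _ = b ^ H.edgeSet.ncard * θ * (n / 2 * (2 * (Fintype.card W + 1))) ^ Fintype.card W := by
        congr 2; ring
    _ = _ := by rw [mul_pow]; ring

end SecondMoment

section Grid

/-- The `j`-th cell of the partition of `(0, 1]` into `N` intervals of equal length. -/
def gridCell (N j : ℕ) : Set ℝ :=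
  Set.Ioc ((j : ℝ) / N) ((j + 1) / N)

theorem measurableSet_gridCell (N j : ℕ) : MeasurableSet (gridCell N j) :=
  measurableSet_Ioc

theorem lt_of_mem_gridCell {N i j : ℕ} (hij : i < j) {x y : ℝ} (hx : x ∈ gridCell N i)
    (hy : y ∈ gridCell N j) : x < y := by
  have hle : (i + 1 : ℝ) / N ≤ j / N := by
    gcongr
    exact_mod_cast hij
  exact (hx.2.trans hle).trans_lt hy.1

theorem disjoint_gridCell (N : ℕ) {i j : ℕ} (hij : i ≠ j) :
    Disjoint (gridCell N i) (gridCell N j) := by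
  refine Set.disjoint_left.2 fun x hi hj => ?_
  rcases hij.lt_or_gt with h | h
  · exact (lt_of_mem_gridCell h hi hj).false
  · exact (lt_of_mem_gridCell h hj hi).false

theorem unifIoc_real_gridCell {N j : ℕ} (hj : j < N) : unifIoc.real (gridCell N j) = 1 / N := by
  have hN : (0 : ℝ) < N := Nat.cast_pos.2 (by omega)
  have hsub : gridCell N j ⊆ Set.Ioc 0 1 :=
    Set.Ioc_subset_Ioc (by positivity) ((div_le_one hN).2 (mod_cast hj))
  rw [measureReal_def, unifIoc, Measure.restrict_eq_self _ hsub, gridCell, Real.volume_Ioc,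
    ← sub_div, add_sub_cancel_left, ENNReal.toReal_ofReal (by positivity)]

theorem sub_lt_of_mem_gridCell {K m : ℕ} {k i j : ℕ} (hi : i < m) {x y : ℝ}
    (hx : x ∈ gridCell (K * m) (k * m + i)) (hy : y ∈ gridCell (K * m) (k * m + j)) :
    x - y < 1 / K := by
  have hm : (m : ℝ) ≠ 0 := Nat.cast_ne_zero.2 (by omega)
  have hx' : x ≤ (k * m + m) / (K * m) := hx.2.trans <| by
    push_cast
    rw [add_assoc]
    gcongr
    exact_mod_cast hi
  have hy' : k * m / (K * m) < y := lt_of_le_of_lt (by push_cast; gcongr; simp) hy.1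
  calc x - y < (k * m + m) / (K * m) - k * m / (K * m) := by linarith
    _ = 1 / K := by
      rw [← sub_div, add_sub_cancel_left, div_mul_cancel_right₀ hm, one_div]

end Grid

section Slots

variable {α : Type*} {K m : ℕ}

/-- The `k`-th window of length `1 / K`, divided into `m` slots of which `a` uses the `σ a`-th.
Only the first candidate label counts, which makes all slots equally likely. -/
def firstLabelSlot (K m : ℕ) (σ : α → ℕ) (k : Fin K) (a : α) : Set (ℕ × (ℕ → ℝ)) :=
  {z | 0 < z.1 ∧ z.2 0 ∈ gridCell (K * m) (k * m + σ a)}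

theorem isSlotFamily_firstLabelSlot (ψ : PMF ℕ) (hψ : 0 < ψ.toMeasure.real {l | 0 < l})
    (hm : m ≠ 0) {σ : α → ℕ} (hσ : ∀ a, σ a < m) :
    IsSlotFamily (edgeLaw ψ) (firstLabelSlot K m σ)
      (ψ.toMeasure.real {l | 0 < l} * (1 / (K * m : ℕ))) (m / ψ.toMeasure.real {l | 0 < l}) where
  measurableSet _ _ := measurableSet_candidate_mem 0 (measurableSet_gridCell _ _)
  disjoint {k k'} hk a a' := by
    refine Set.disjoint_left.2 fun z hz hz' => ?_
    refine (disjoint_gridCell (K * m) fun h => hk (Fin.ext ?_)).notMem_of_mem_left hz.2 hz'.2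
    have hdiv := congrArg (· / m) h
    simpa [Nat.mul_add_div (Nat.pos_of_ne_zero hm), mul_comm _ m,
      Nat.div_eq_of_lt (hσ _)] using hdiv
  one_le := by
    rw [one_le_div hψ]
    exact measureReal_le_one.trans (Nat.one_le_cast.2 (Nat.one_le_iff_ne_zero.2 hm))
  inv_eq := by
    rw [Fintype.card_fin, Nat.cast_mul, mul_one_div, inv_div, mul_div_assoc]
  measureReal_eq k a := by
    have hlt : (k : ℕ) * m + σ a < K * m :=
      (Nat.add_lt_add_left (hσ a) _).trans_le (Nat.succ_mul _ _ ▸ Nat.mul_le_mul_right m k.2)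
    rw [measureReal_def, firstLabelSlot, edgeLaw_candidate_mem ψ 0 (measurableSet_gridCell _ _),
      ENNReal.toReal_mul, ← measureReal_def, ← measureReal_def, unifIoc_real_gridCell hlt]

theorem containsMotif_of_mem_placedCopy {V W : Type*} {H : SimpleGraph W}
    {P : H.edgeSet → H.edgeSet → Prop} {σ : H.edgeSet → ℕ} (hσ : ∀ e, σ e < m)
    (hP : ∀ e f, P e f → σ e < σ f) {δ : ℝ} (hδ : 1 / K ≤ δ) {k : Fin K} {φ : W ↪ V}
    {ω : LabelSpace V} (hω : ω ∈ placedCopy (firstLabelSlot K m σ k) φ) :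
    (sampledGraph ω).ContainsMotif H P δ :=
  sampledGraph_containsMotif_iff.2 ⟨φ, fun e => (ω (edgeImage φ e)).2 0,
    fun e => ⟨0, (hω e).1, rfl⟩,
    fun e f hef => lt_of_mem_gridCell (Nat.add_lt_add_left (hP e f hef) _) (hω e).2 (hω f).2,
    fun e f => (sub_lt_of_mem_gridCell (hσ e) (hω e).2 (hω f).2).trans_le hδ⟩

end Slots

section Threshold

theorem exists_labelMeasure_not_containsMotif_le {W : Type*} [Fintype W] {H : SimpleGraph W}
    [Nonempty H.edgeSet] (P : H.edgeSet → H.edgeSet → Prop) [IsStrictOrder H.edgeSet P]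
    {ψ : PMF ℕ} (hψ : 0 < meanMultiplicity ψ) :
    ∃ C : ℝ, ∀ (V : Type*) [Fintype V] [DecidableEq V] [Nonempty V] (K : ℕ) (δ : ℝ), K ≠ 0 →
      1 / K ≤ δ → 2 * Fintype.card W ≤ Fintype.card V →
      (K : ℝ) ≤ (Fintype.card V : ℝ) ^ sparsity H →
      (labelMeasure V ψ).real {ω | ¬ (sampledGraph ω).ContainsMotif H P δ} ≤
        C * (1 / Fintype.card V + K / (Fintype.card V : ℝ) ^ sparsity H) := by
  obtain ⟨σ, hσ, hP⟩ := exists_lt_card_strictMono P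
  have hp : 0 < ψ.toMeasure.real {l | 0 < l} :=
    ENNReal.toReal_pos (toMeasure_pos_of_meanMultiplicity_pos hψ).ne' (measure_ne_top _ _)
  refine ⟨(Nat.card H.edgeSet / ψ.toMeasure.real {l | 0 < l}) ^ H.edgeSet.ncard *
    (2 * (Fintype.card W + 1)) ^ Fintype.card W, fun V _ _ _ K δ hK hδ hV hKV => ?_⟩
  have : NeZero K := ⟨hK⟩
  have h := isSlotFamily_firstLabelSlot (K := K) ψ hp Nat.card_pos.ne' hσ
  have hbound := h.measureReal_iInter_compl_placedCopy_le hV (by rwa [Fintype.card_fin])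
  rw [Fintype.card_fin] at hbound
  refine (measureReal_mono fun ω hω => Set.mem_iInter.2 fun x hx => ?_).trans hbound
  exact hω (containsMotif_of_mem_placedCopy hσ hP hδ hx)

theorem tendsto_natCeil_inv_div_rpow {ρ : ℝ} (hρ : 0 < ρ) {δ : ℕ → ℝ}
    (hδ : Tendsto (fun n : ℕ => δ n / (n : ℝ) ^ (-ρ)) atTop atTop) :
    Tendsto (fun n : ℕ => (⌈(δ n)⁻¹⌉₊ : ℝ) / (n : ℝ) ^ ρ) atTop (𝓝 0) := by
  have hpow : Tendsto (fun n : ℕ => (n : ℝ) ^ (-ρ)) atTop (𝓝 0) :=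
    (tendsto_rpow_neg_atTop hρ).comp tendsto_natCast_atTop_atTop
  have hlim := hδ.inv_tendsto_atTop.add hpow
  rw [zero_add] at hlim
  refine tendsto_of_tendsto_of_tendsto_of_le_of_le' tendsto_const_nhds hlim
    (Eventually.of_forall fun n => by positivity) ?_
  filter_upwards [hδ.eventually_gt_atTop 0, eventually_gt_atTop 0] with n hn hn0
  have hδn : 0 < δ n := (div_pos_iff_of_pos_right (by positivity)).1 hn
  calc (⌈(δ n)⁻¹⌉₊ : ℝ) / (n : ℝ) ^ ρ ≤ ((δ n)⁻¹ + 1) / (n : ℝ) ^ ρ := by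
        gcongr
        exact (Nat.ceil_lt_add_one (by positivity)).le
    _ = (δ n / (n : ℝ) ^ (-ρ))⁻¹ + (n : ℝ) ^ (-ρ) := by
        rw [Real.rpow_neg n.cast_nonneg, div_inv_eq_mul, mul_inv, add_div, div_eq_mul_inv,
          one_div]

theorem tendsto_containsMotif {W : Type*} [Finite W] (H : SimpleGraph W)
    (hH : 2 ≤ H.edgeSet.ncard) (P : H.edgeSet → H.edgeSet → Prop) [IsStrictOrder H.edgeSet P]
    (ψ : PMF ℕ) (hψ : 0 < meanMultiplicity ψ) (δ : ℕ → ℝ)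
    (hδ : Tendsto (fun n : ℕ => δ n / (n : ℝ) ^ (-sparsity H)) atTop atTop) :
    Tendsto (fun n : ℕ => labelMeasure (Fin n) ψ
      {ω | (sampledGraph ω).ContainsMotif H P (δ n)}) atTop (𝓝 1) := by
  have := Fintype.ofFinite W
  have : Nonempty H.edgeSet := (Set.nonempty_of_ncard_ne_zero (by omega)).to_subtype
  obtain ⟨C, hC⟩ := exists_labelMeasure_not_containsMotif_le P hψ
  have hK := tendsto_natCeil_inv_div_rpow (sparsity_pos hH) hδ
  have hbound : ∀ᶠ n : ℕ in atTop,
      (labelMeasure (Fin n) ψ).real {ω | ¬ (sampledGraph ω).ContainsMotif H P (δ n)} ≤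
        C * (1 / n + ⌈(δ n)⁻¹⌉₊ / (n : ℝ) ^ sparsity H) := by
    filter_upwards [hδ.eventually_gt_atTop 0, hK.eventually_le_const one_pos,
      eventually_ge_atTop (2 * Fintype.card W), eventually_gt_atTop 0] with n hn hKn hWn hn0
    have : NeZero n := ⟨hn0.ne'⟩
    have hδn : 0 < δ n := (div_pos_iff_of_pos_right (by positivity)).1 hn
    have h := hC (Fin n) ⌈(δ n)⁻¹⌉₊ (δ n) (Nat.ceil_pos.2 (inv_pos.2 hδn)).ne'
    rw [Fintype.card_fin] at h
    refine h ?_ hWn ((div_le_one (by positivity)).1 hKn)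
    rw [one_div]
    exact inv_le_of_inv_le₀ hδn (Nat.le_ceil _)
  have hlim := (tendsto_one_div_atTop_nhds_zero_nat.add hK).const_mul C
  rw [add_zero, mul_zero] at hlim
  have hreal := squeeze_zero' (Eventually.of_forall fun _ => measureReal_nonneg) hbound hlim
  refine tendsto_measure_one_of_tendsto_measure_compl_zero ?_
  have h := ENNReal.tendsto_ofReal hreal
  simp only [ofReal_measureReal (measure_ne_top _ _), ENNReal.ofReal_zero] at h
  exact h

end Threshold

theorem mainTheorem1_general {W : Type*} [Finite W] (H : SimpleGraph W)
    (hH : 2 ≤ H.edgeSet.ncard)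
    (P : H.edgeSet → H.edgeSet → Prop) [IsStrictOrder H.edgeSet P] (ψ : PMF ℕ) (δ : ℕ → ℝ) :
    (0 < meanMultiplicity ψ →
      Tendsto (fun n : ℕ => δ n / (n : ℝ) ^ (-sparsity H)) atTop atTop →
      Tendsto (fun n : ℕ => labelMeasure (Fin n) ψ
        {ω | (sampledGraph ω).ContainsMotif H P (δ n)}) atTop (𝓝 1)) ∧
    (meanMultiplicity ψ < ⊤ → δ =o[atTop] (fun n : ℕ => (n : ℝ) ^ (-sparsity H)) →
      Tendsto (fun n : ℕ => labelMeasure (Fin n) ψ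
        {ω | ¬ (sampledGraph ω).ContainsMotif H P (δ n)}) atTop (𝓝 1)) :=
  ⟨fun hψ hδ => tendsto_containsMotif H hH P ψ hψ δ hδ,
    fun hψ hδ => tendsto_not_containsMotif H hH P ψ hψ δ hδ⟩

theorem mainTheorem1 {W : Type*} [Fintype W] (H : SimpleGraph W)
    (hH : 2 ≤ H.edgeSet.ncard)
    (P : H.edgeSet → H.edgeSet → Prop) [IsStrictOrder H.edgeSet P]
    (ψ : PMF ℕ) (hψ : IsLabelMultiplicity ψ) (δ : ℕ → ℝ) :
    (Tendsto (fun n : ℕ => δ n / (n : ℝ) ^ (-sparsity H)) atTop atTop →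
      Tendsto (fun n : ℕ => labelMeasure (Fin n) ψ
        {ω | (sampledGraph ω).ContainsMotif H P (δ n)}) atTop (𝓝 1)) ∧
    (δ =o[atTop] (fun n : ℕ => (n : ℝ) ^ (-sparsity H)) →
      Tendsto (fun n : ℕ => labelMeasure (Fin n) ψ
        {ω | ¬ (sampledGraph ω).ContainsMotif H P (δ n)}) atTop (𝓝 1)) :=
  (mainTheorem1_general H hH P ψ δ).imp (· hψ.first_pos) (· hψ.first_lt_top)
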